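/- Let $d\ge 2$ and let $a:(0,\infty)\to(0,\infty)$ be a $C^2$ function with $a(t)\to 0$ as $t\to 0$ and $\int_0^1\frac{dt}{a(t)}=\infty$ (no particle horizons). Let $(\overline M_{-1},\overline g_{-1})$ be $d$-dimensional hyperbolic space (the simply connected complete Riemannian manifold of constant curvature $-1$), and let $M=(0,\infty)\times\overline M_{-1}$ carry the Lorentzian metric $g=-dt^2+a(t)^2\,\overline g_{-1}$, time-oriented so that $\partial_t$ is future directed. Timelike curves are piecewise smooth with timelike tangents (on a non-compact interval: piecewise smooth on every compact subinterval), the future directed ones having future directed one-sided tangents everywhere, break points included; $I^+(q,M)$ is the set of points that can be reached from $q\in M$ by a future directed timelike curve in $M$. A timelike curve $\gamma:(0,1]\to M$ is past inextendible if it is future directed and $\gamma(s)$ has no limit in $M$ as $s\to 0$. Fix $\overline p\in\overline M_{-1}$ with spherical normal coordinates $(r,\omega)$ centred at $\overline p$, so that $\overline g_{-1}=dr^2+\sinh^2(r)\,g_{\mathbb S^{d-1}}$, where $\mathbb S^{d-1}$ is the unit sphere of $T_{\overline p}\overline M_{-1}$. Set $\tau(t)=\int_1^t\frac{dt'}{a(t')}$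 and $u=r+\tau$. a) Let $\gamma:(0,1]\to M$ be a future directed and past inextendible timelike curve. Then either i) $\lim_{s\to0}u(\gamma(s))=-\infty$, or ii) $\lim_{s\to0}u(\gamma(s))=u_0$ for some $u_0\in\mathbb R$, $\lim_{s\to0}r(\gamma(s))=\infty$, and $\lim_{s\to0}\omega(\gamma(s))=\omega_0$ for some $\omega_0\in\mathbb S^{d-1}$. b) In case i), $\bigcup_{0<s\le1}I^+(\gamma(s),M)=M$. c) Let $\gamma_1,\gamma_2:(0,1]\to M$ be two future directed and past inextendible timelike curves with $\lim_{s\to0}u(\gamma_i(s))=u_i\in\mathbb R$ and $\lim_{s\to0}\omega(\gamma_i(s))=\omega_i\in\mathbb S^{d-1}$ for $i=1,2$. 1) If $\omega_1=\omega_2$ and $u_1=u_2$, then $\bigcup_{0<s\le1}I^+(\gamma_1(s),M)=\bigcup_{0<s\le1}I^+(\gamma_2(s),M)$. 2) If $\omega_1=\omega_2$ and $u_1<u_2$, then $\bigcup_{0<s\le1}I^+(\gamma_1(s),M)\supseteq\bigcup_{0<s\le1}I^+(\gamma_2(s),M)$. -/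

import Mathlib

open Set Filter Topology MeasureTheory
open scoped ContDiff

noncomputable section

namespace FLRW

/-- The vector space `ℝ^{1,d}` in which hyperbolic space is realised. -/
abbrev Mink (d : ℕ) : Type := ℝ × EuclideanSpace ℝ (Fin d)

/-- The Minkowski form `⟨X, Y⟩ = - X⁰ Y⁰ + X¹ Y¹ + ⋯ + Xᵈ Yᵈ` on `ℝ^{1,d}`. -/
def mink {d : ℕ} (X Y : Mink d) : ℝ := -(X.1 * Y.1) + inner ℝ X.2 Y.2

/-- The simply connected complete `d`-dimensional Riemannian manifold of constant curvature `-1`: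
the upper sheet of the hyperboloid `⟨x, x⟩ = -1`, with the Riemannian metric induced by the
Minkowski form. -/
def hyperbolicSpace (d : ℕ) : Set (Mink d) := {x | mink x x = -1 ∧ 0 < x.1}

/-- The unit sphere `𝕊^{d-1}` in the tangent space at `p` of hyperbolic space, the tangent space
being the Minkowski-orthogonal complement of `p`. -/
def unitTangentSphere {d : ℕ} (p : Mink d) : Set (Mink d) := {w | mink p w = 0 ∧ mink w w = 1}

/-- The point with spherical normal coordinates `(r, w)` centred at `p`: the unit speed geodesic
which starts at `p` in the direction `w`, evaluated at `r`, that is, `exp_p (r w)`. -/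
def polar {d : ℕ} (p : Mink d) (r : ℝ) (w : Mink d) : Mink d :=
  Real.cosh r • p + Real.sinh r • w

/-- The radial coordinate `r` of the spherical normal coordinates centred at `p`
(the hyperbolic distance to `p`). -/
def radius {d : ℕ} (p x : Mink d) : ℝ := Real.arcosh (-mink p x)

/-- The angular coordinate `ω` of the spherical normal coordinates centred at `p`, as a unit
tangent vector at `p`. It is meaningful for `x ≠ p` only. -/
def angle {d : ℕ} (p x : Mink d) : Mink d :=
  (Real.sinh (radius p x))⁻¹ • (x - Real.cosh (radius p x) • p)

/-- The manifold `M = (0, ∞) × ℍᵈ`. -/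
def spacetime (d : ℕ) : Set (ℝ × Mink d) := {q | 0 < q.1 ∧ q.2 ∈ hyperbolicSpace d}

/-- Scale factors: `a : (0, ∞) → (0, ∞)` is twice continuously differentiable and `a(t) → 0` for
`t → 0`. Values of `a` outside `(0, ∞)` are irrelevant. -/
structure IsScaleFactor (a : ℝ → ℝ) : Prop where
  pos : ∀ t, 0 < t → 0 < a t
  contDiffOn : ContDiffOn ℝ 2 a (Ioi 0)
  tendsto_zero : Tendsto a (𝓝[>] 0) (𝓝 0)

/-- Absence of particle horizons: `∫_0^1 1 / a(t) dt = ∞`. -/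
def NoParticleHorizons (a : ℝ → ℝ) : Prop :=
  ∫⁻ t in Ioc (0 : ℝ) 1, ENNReal.ofReal (1 / a t) = ⊤

/-- The Lorentzian metric `g = - dt² + a(t)² ḡ` at a point with time coordinate `t`. -/
def metric {d : ℕ} (a : ℝ → ℝ) (t : ℝ) (v w : ℝ × Mink d) : ℝ :=
  -(v.1 * w.1) + a t ^ 2 * mink v.2 w.2

/-- A tangent vector `v` at `q` is timelike and future directed (`∂_t` being future directed). -/
def IsFutureTimelike {d : ℕ} (a : ℝ → ℝ) (q v : ℝ × Mink d) : Prop :=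
  metric a q.1 v v < 0 ∧ 0 < v.1

/-- `γ` restricted to the compact interval `[α, β]` is a future directed timelike curve in `M`:
it is piecewise smooth, that is, a finite concatenation of curves smooth on compact intervals
(up to and including the endpoints), all of whose tangent vectors, including both one-sided ones
at the break points, are timelike and future directed. -/
inductive IsFutureTimelikeOn {d : ℕ} (a : ℝ → ℝ) (γ : ℝ → ℝ × Mink d) : ℝ → ℝ → Prop
  | smooth {α β : ℝ} (hlt : α < β) (hmaps : MapsTo γ (Icc α β) (spacetime d))
      (hsmooth : ContDiffOn ℝ ∞ γ (Icc α β))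
      (htimelike : ∀ s ∈ Icc α β, IsFutureTimelike a (γ s) (derivWithin γ (Icc α β) s)) :
      IsFutureTimelikeOn a γ α β
  | concat {α β δ : ℝ} (h₁ : IsFutureTimelikeOn a γ α β) (h₂ : IsFutureTimelikeOn a γ β δ) :
      IsFutureTimelikeOn a γ α δ

/-- The timelike future `I⁺(q, M)`. -/
def timelikeFuture {d : ℕ} (a : ℝ → ℝ) (q : ℝ × Mink d) : Set (ℝ × Mink d) :=
  {q' | ∃ (σ : ℝ → ℝ × Mink d) (α β : ℝ), IsFutureTimelikeOn a σ α β ∧ σ α = q ∧ σ β = q'}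

/-- `γ : (0, 1] → M` is a future directed timelike curve (piecewise smooth on every compact
subinterval) which is past inextendible: it has no limit point in `M` for `s → 0`. Values of `γ`
outside `(0, 1]` are irrelevant. -/
structure IsPastInextendibleTimelike {d : ℕ} (a : ℝ → ℝ) (γ : ℝ → ℝ × Mink d) : Prop where
  timelike : ∀ α β : ℝ, 0 < α → α < β → β ≤ 1 → IsFutureTimelikeOn a γ α β
  inextendible : ¬ ∃ q ∈ spacetime d, Tendsto γ (𝓝[>] 0) (𝓝 q)

/-- The terminal indecomposable future set `⋃_{0 < s ≤ 1} I⁺(γ(s), M)` of a curve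
`γ : (0, 1] → M`. -/
def tif {d : ℕ} (a : ℝ → ℝ) (γ : ℝ → ℝ × Mink d) : Set (ℝ × Mink d) :=
  ⋃ s ∈ Ioc (0 : ℝ) 1, timelikeFuture a (γ s)

/-- The conformal time `τ(t) = ∫_1^t 1 / a(t') dt'`. -/
def conformalTime (a : ℝ → ℝ) (t : ℝ) : ℝ := ∫ t' in (1 : ℝ)..t, 1 / a t'

/-- The null coordinate `u = r + τ`, with `r` the radial coordinate centred at `p`. -/
def nullCoord {d : ℕ} (a : ℝ → ℝ) (p : Mink d) (q : ℝ × Mink d) : ℝ :=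
  radius p q.2 + conformalTime a q.1

/-- `polar p` takes values in hyperbolic space. -/
theorem mink_polar {d : ℕ} {p w : Mink d} (hp : p ∈ hyperbolicSpace d)
    (hw : w ∈ unitTangentSphere p) (r : ℝ) :
    mink p (polar p r w) = -Real.cosh r ∧ mink (polar p r w) (polar p r w) = -1 := by
  obtain ⟨h1, -⟩ := hp
  obtain ⟨h2, h3⟩ := hw
  have hc := Real.cosh_sq r
  simp only [mink, polar, Prod.fst_add, Prod.snd_add, Prod.smul_fst, Prod.smul_snd, smul_eq_mul,
    inner_add_left, inner_add_right, real_inner_smul_left, real_inner_smul_right] at *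
  rw [real_inner_comm p.2 w.2]
  constructor
  · linear_combination Real.cosh r * h1 + Real.sinh r * h2
  · linear_combination Real.cosh r ^ 2 * h1 + 2 * Real.cosh r * Real.sinh r * h2 +
      Real.sinh r ^ 2 * h3 - hc

/-- `radius` and `angle` are the coordinates of the chart whose inverse is `polar`. -/
theorem radius_angle_polar {d : ℕ} {p w : Mink d} (hp : p ∈ hyperbolicSpace d)
    (hw : w ∈ unitTangentSphere p) {r : ℝ} (hr : 0 < r) :
    radius p (polar p r w) = r ∧ angle p (polar p r w) = w := by
  have h : radius p (polar p r w) = r := by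
    rw [radius, (mink_polar hp hw r).1, neg_neg, Real.arcosh_cosh hr.le]
  refine ⟨h, ?_⟩
  have hs : Real.sinh r ≠ 0 := (Real.sinh_pos_iff.2 hr).ne'
  rw [angle, h, polar, add_sub_cancel_left, smul_smul, inv_mul_cancel₀ hs, one_smul]

end FLRW

end

open FLRW

noncomputable section

namespace FLRW

/-! The map `coneMap`, `(t, x) ↦ e^τ(t) x`, is a conformal embedding of `M` into the open future
cone of Minkowski space: both metrics are positive multiples of `-dτ² + ḡ`. It turns the causality
of `M` into linear algebra: `q'` lies in the timelike future of `q` exactly when the difference of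
their images is a future timelike vector (`mem_timelikeFuture_iff`).

Towards the past the image of a timelike curve decreases in the cone order and is bounded below by
the apex, so it converges to a causal vector `Y₀` (`exists_tendsto_of_sub_mem_futureCone`). If `Y₀`
were timelike, the curve would converge in `M`; this step needs `τ → -∞` at the big bang. Hence `Y₀`
is null (`mink_limit_eq_zero`).

If `Y₀ = 0`, then `u → -∞`; otherwise `Y₀ = (e^u₀ / 2) (p + ω₀)`, with `u₀` and `ω₀` the limits of
the coordinates (`tendsto_of_null`, `limit_eq`). The future set of the curve is the part of `M` in
the open cone with apex `Y₀` (`tif_eq`), so b) and c) reduce to comparing translated cones. -/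

/-- The open future cone of Minkowski space. -/
def futureCone (d : ℕ) : Set (Mink d) := {V | ‖V.2‖ < V.1}

/-- The closed future cone of Minkowski space. -/
def causalCone (d : ℕ) : Set (Mink d) := {V | ‖V.2‖ ≤ V.1}

variable {d : ℕ}

/-! ### Linear algebra of the cones and the Minkowski form. -/

theorem isOpen_futureCone : IsOpen (futureCone d) :=
  isOpen_lt (by fun_prop) (by fun_prop)

theorem isClosed_causalCone : IsClosed (causalCone d) :=
  isClosed_le (by fun_prop) (by fun_prop)

theorem futureCone_subset_causalCone : futureCone d ⊆ causalCone d :=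
  fun V hV => show ‖V.2‖ ≤ V.1 from le_of_lt (show ‖V.2‖ < V.1 from hV)

theorem add_mem_futureCone {V W : Mink d} (hV : V ∈ futureCone d) (hW : W ∈ causalCone d) :
    V + W ∈ futureCone d := by
  simp only [futureCone, causalCone, mem_ofPred_eq, Prod.fst_add, Prod.snd_add] at *
  linarith [norm_add_le V.2 W.2]

theorem smul_mem_causalCone {V : Mink d} (hV : V ∈ causalCone d) {c : ℝ} (hc : 0 ≤ c) :
    c • V ∈ causalCone d := by
  simp only [causalCone, mem_ofPred_eq, Prod.smul_fst, Prod.smul_snd, norm_smul,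
    Real.norm_of_nonneg hc, smul_eq_mul] at *
  gcongr

theorem mink_comm (X Y : Mink d) : mink X Y = mink Y X := by
  simp only [mink, real_inner_comm X.2 Y.2, mul_comm]

theorem mink_add_left (X Y Z : Mink d) : mink (X + Y) Z = mink X Z + mink Y Z := by
  simp only [mink, Prod.fst_add, Prod.snd_add, inner_add_left]; ring

theorem mink_smul_left (c : ℝ) (X Y : Mink d) : mink (c • X) Y = c * mink X Y := by
  simp only [mink, Prod.smul_fst, Prod.smul_snd, real_inner_smul_left, smul_eq_mul]; ring

theorem mink_add_right (X Y Z : Mink d) : mink X (Y + Z) = mink X Y + mink X Z := by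
  rw [mink_comm, mink_add_left, mink_comm Y, mink_comm Z]

theorem mink_smul_right (c : ℝ) (X Y : Mink d) : mink X (c • Y) = c * mink X Y := by
  rw [mink_comm, mink_smul_left, mink_comm]

theorem mink_sub_left (X Y Z : Mink d) : mink (X - Y) Z = mink X Z - mink Y Z := by
  simp only [mink, Prod.fst_sub, Prod.snd_sub, inner_sub_left]; ring

theorem mink_sub_right (X Y Z : Mink d) : mink X (Y - Z) = mink X Y - mink X Z := by
  rw [mink_comm, mink_sub_left, mink_comm Y, mink_comm Z]

theorem continuous_mink : Continuous fun X : Mink d × Mink d => mink X.1 X.2 := by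
  unfold mink; fun_prop

theorem mink_self (X : Mink d) : mink X X = ‖X.2‖ ^ 2 - X.1 ^ 2 := by
  rw [mink, real_inner_self_eq_norm_sq]; ring

theorem mink_self_neg_of_mem_futureCone {V : Mink d} (hV : V ∈ futureCone d) : mink V V < 0 := by
  have h : ‖V.2‖ < V.1 := hV
  rw [mink_self]
  nlinarith [norm_nonneg V.2]

theorem mem_futureCone_of_mink_self_neg {V : Mink d} (h : mink V V < 0) (h0 : 0 ≤ V.1) :
    V ∈ futureCone d := by
  rw [mink_self] at h
  exact lt_of_pow_lt_pow_left₀ 2 h0 (by linarith)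

theorem mink_self_nonpos_of_mem_causalCone {V : Mink d} (hV : V ∈ causalCone d) :
    mink V V ≤ 0 := by
  have h : ‖V.2‖ ≤ V.1 := hV
  rw [mink_self]
  nlinarith [norm_nonneg V.2]

theorem hyperbolicSpace_subset_futureCone : hyperbolicSpace d ⊆ futureCone d :=
  fun x hx => mem_futureCone_of_mink_self_neg (by rw [hx.1]; norm_num) hx.2.le

/-- The quantitative form of the fact that future causal vectors have negative product. -/
theorem mul_le_neg_mink {V W : Mink d} (hW : W ∈ causalCone d) :
    (V.1 - ‖V.2‖) * W.1 ≤ -mink V W := by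
  have h : ‖W.2‖ ≤ W.1 := hW
  have := real_inner_le_norm V.2 W.2
  rw [mink]
  nlinarith [norm_nonneg V.2]

theorem mink_neg {V W : Mink d} (hV : V ∈ futureCone d) (hW : W ∈ futureCone d) :
    mink V W < 0 := by
  have h := mul_le_neg_mink (V := V) (futureCone_subset_causalCone hW)
  have h1 : ‖V.2‖ < V.1 := hV
  have h2 : ‖W.2‖ < W.1 := hW
  nlinarith [norm_nonneg W.2]

theorem eq_zero_of_mem_causalCone {W : Mink d} (hW : W ∈ causalCone d) (h : W.1 ≤ 0) : W = 0 := by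
  have h1 : ‖W.2‖ ≤ W.1 := hW
  have h2 := norm_nonneg W.2
  exact Prod.ext (by simp; linarith) (norm_eq_zero.1 (by linarith))

/-- If the time component of `W` were negative, `-W` would be future timelike and its product with
`V` negative. -/
theorem mem_futureCone_of_mink_neg {V W : Mink d} (hV : V ∈ futureCone d) (hW : mink W W < 0)
    (h : mink V W < 0) : W ∈ futureCone d := by
  refine mem_futureCone_of_mink_self_neg hW ?_
  by_contra! h0
  have := mink_neg hV (mem_futureCone_of_mink_self_neg (V := (-1 : ℝ) • W)
    (by rw [mink_smul_left, mink_smul_right]; linarith) (by simp; linarith))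
  rw [mink_smul_right] at this
  linarith

/-- The orthogonal complement of a timelike vector is spacelike. -/
theorem eq_zero_of_mink_eq_zero {V W : Mink d} (hV : V ∈ futureCone d) (h : mink V W = 0)
    (hW : mink W W ≤ 0) : W = 0 := by
  have h1 : ‖V.2‖ < V.1 := hV
  have h2 : ‖W.2‖ ≤ |W.1| := by
    rw [mink_self] at hW
    exact abs_le_of_sq_le_sq' (by simpa using hW) (abs_nonneg _) |>.2
  have h3 : V.1 * |W.1| ≤ ‖V.2‖ * ‖W.2‖ := by
    have h4 : V.1 * W.1 = inner ℝ V.2 W.2 := by rw [mink] at h; linarith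
    have h5 := abs_real_inner_le_norm V.2 W.2
    rwa [← h4, abs_mul, abs_of_pos ((norm_nonneg _).trans_lt h1)] at h5
  have h6 : |W.1| = 0 := by
    have := mul_le_mul_of_nonneg_left h2 (norm_nonneg V.2)
    nlinarith [abs_nonneg W.1]
  rw [h6] at h2
  exact Prod.ext (abs_eq_zero.1 h6) (norm_le_zero_iff.1 h2)

/-! ### Hyperbolic distance and polar coordinates. -/

theorem one_lt_neg_mink {x y : Mink d} (hx : x ∈ hyperbolicSpace d) (hy : y ∈ hyperbolicSpace d)
    (hne : x ≠ y) : 1 < -mink x y := by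
  have hx' := hyperbolicSpace_subset_futureCone hx
  have h0 := mink_neg hx' (hyperbolicSpace_subset_futureCone hy)
  by_contra! hle
  -- This is the component of `y` orthogonal to `x`; its square `⟨x, y⟩² - 1` would be nonpositive,
  -- although the complement of `x` is spacelike.
  have h1 : y + mink x y • x = 0 := by
    apply eq_zero_of_mink_eq_zero hx'
    · rw [mink_add_right, mink_smul_right, hx.1]; ring
    · simp only [mink_add_right, mink_smul_right, mink_add_left, mink_smul_left, hx.1, hy.1,
        mink_comm y x]
      nlinarith
  have h2 : mink x y ^ 2 = 1 := by
    have := congrArg (mink y) h1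
    rw [mink_add_right, mink_smul_right, hy.1, mink_comm y x] at this
    have h3 : mink y (0 : Mink d) = 0 := by simp [mink]
    linarith
  have h4 : mink x y = -1 := by nlinarith
  rw [h4, neg_one_smul, add_neg_eq_zero] at h1
  exact hne h1.symm

theorem cosh_radius {x y : Mink d} (hx : x ∈ hyperbolicSpace d) (hy : y ∈ hyperbolicSpace d) :
    Real.cosh (radius x y) = -mink x y := by
  refine Real.cosh_arcosh ?_
  by_cases h : x = y
  · rw [← h, hx.1]; norm_num
  · exact (one_lt_neg_mink hx hy h).le

theorem radius_nonneg {x y : Mink d} (hx : x ∈ hyperbolicSpace d) (hy : y ∈ hyperbolicSpace d) :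
    0 ≤ radius x y := by
  refine Real.arcosh_nonneg ?_
  rw [← cosh_radius hx hy]; exact Real.one_le_cosh _

theorem radius_pos {x y : Mink d} (hx : x ∈ hyperbolicSpace d) (hy : y ∈ hyperbolicSpace d)
    (hne : x ≠ y) : 0 < radius x y := by
  refine (radius_nonneg hx hy).lt_of_ne fun h => ?_
  have := cosh_radius hx hy
  rw [← h, Real.cosh_zero] at this
  linarith [one_lt_neg_mink hx hy hne]

theorem angle_mem_unitTangentSphere {x y : Mink d} (hx : x ∈ hyperbolicSpace d)
    (hy : y ∈ hyperbolicSpace d) (hne : x ≠ y) : angle x y ∈ unitTangentSphere x := by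
  have hs := (Real.sinh_pos_iff.2 (radius_pos hx hy hne)).ne'
  have hc := cosh_radius hx hy
  have hcs := Real.cosh_sq (radius x y)
  have hm : mink x y = -Real.cosh (radius x y) := by linarith
  constructor
  · simp only [angle, mink_smul_right, mink_sub_right, hx.1, hm]; ring
  · simp only [angle, mink_smul_right, mink_sub_right, mink_smul_left, mink_sub_left, hx.1, hy.1,
      mink_comm y x, hm]
    field_simp
    linarith

theorem polar_radius_angle {x y : Mink d} (hx : x ∈ hyperbolicSpace d)
    (hy : y ∈ hyperbolicSpace d) (hne : x ≠ y) : polar x (radius x y) (angle x y) = y := by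
  have hs := (Real.sinh_pos_iff.2 (radius_pos hx hy hne)).ne'
  rw [polar, angle, smul_smul, mul_inv_cancel₀ hs, one_smul, add_sub_cancel]

theorem polar_mem_hyperbolicSpace {x w : Mink d} (hx : x ∈ hyperbolicSpace d)
    (hw : w ∈ unitTangentSphere x) (r : ℝ) : polar x r w ∈ hyperbolicSpace d := by
  obtain ⟨h1, h2⟩ := mink_polar hx hw r
  have h3 := mem_futureCone_of_mink_neg (hyperbolicSpace_subset_futureCone hx)
    (by rw [h2]; norm_num) (by rw [h1]; linarith [Real.cosh_pos r])
  exact ⟨h2, (norm_nonneg _).trans_lt h3⟩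

/-! Conformal time. -/

variable {a : ℝ → ℝ}

theorem IsScaleFactor.continuousOn_inv (ha : IsScaleFactor a) :
    ContinuousOn (fun t => 1 / a t) (Ioi 0) :=
  continuousOn_const.div ha.contDiffOn.continuousOn fun t ht => (ha.pos t ht).ne'

theorem IsScaleFactor.intervalIntegrable (ha : IsScaleFactor a) {s t : ℝ} (hs : 0 < s)
    (ht : 0 < t) : IntervalIntegrable (fun t => 1 / a t) volume s t :=
  (ha.continuousOn_inv.mono fun _ hx => (lt_min hs ht).trans_le hx.1).intervalIntegrable

theorem hasDerivAt_conformalTime (ha : IsScaleFactor a) {t : ℝ} (ht : 0 < t) :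
    HasDerivAt (conformalTime a) (1 / a t) t :=
  intervalIntegral.integral_hasDerivAt_right (ha.intervalIntegrable one_pos ht)
    (ha.continuousOn_inv.stronglyMeasurableAtFilter isOpen_Ioi t ht)
    (ha.continuousOn_inv.continuousAt (Ioi_mem_nhds ht))

theorem conformalTime_sub (ha : IsScaleFactor a) {s t : ℝ} (hs : 0 < s) (ht : 0 < t) :
    conformalTime a t - conformalTime a s = ∫ t' in s..t, 1 / a t' :=
  intervalIntegral.integral_interval_sub_left (ha.intervalIntegrable one_pos ht)
    (ha.intervalIntegrable one_pos hs)

theorem continuousOn_conformalTime (ha : IsScaleFactor a) :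
    ContinuousOn (conformalTime a) (Ioi 0) :=
  fun _ ht => (hasDerivAt_conformalTime ha ht).continuousAt.continuousWithinAt

theorem strictMonoOn_conformalTime (ha : IsScaleFactor a) :
    StrictMonoOn (conformalTime a) (Ioi 0) := by
  refine strictMonoOn_of_deriv_pos (convex_Ioi 0) (continuousOn_conformalTime ha) fun t ht => ?_
  rw [interior_Ioi] at ht
  rw [(hasDerivAt_conformalTime ha ht).deriv]
  exact one_div_pos.2 (ha.pos t ht)

/-- Without particle horizons the conformal time is unbounded below at the big bang. -/
theorem exists_conformalTime_lt (ha : IsScaleFactor a) (hph : NoParticleHorizons a) (L : ℝ) :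
    ∃ t, 0 < t ∧ conformalTime a t < L := by
  by_contra! h
  have hpos : ∀ n : ℕ, (0 : ℝ) < 1 / ((n : ℝ) + 1) := fun n => by positivity
  have hle : ∀ n : ℕ, 1 / ((n : ℝ) + 1) ≤ 1 := fun n => by
    rw [div_le_one (by positivity)]; linarith [n.cast_nonneg (α := ℝ)]
  have hint : IntegrableOn (fun t => 1 / a t) (Ioc 0 1) := by
    refine integrableOn_Ioc_of_intervalIntegral_norm_bounded_left (l := atTop) (I := -L)
      (a := fun n : ℕ => 1 / ((n : ℝ) + 1)) (fun n => ?_) tendsto_one_div_add_atTop_nhds_zero_nat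
      (Eventually.of_forall fun n => ?_)
    · exact (intervalIntegrable_iff_integrableOn_Ioc_of_le (hle n)).1
        (ha.intervalIntegrable (hpos n) one_pos)
    · have h1 := h _ (hpos n)
      rw [conformalTime, intervalIntegral.integral_symm,
        intervalIntegral.integral_of_le (hle n)] at h1
      have h2 : ∫ x in Ioc (1 / ((n : ℝ) + 1)) 1, ‖1 / a x‖ =
          ∫ x in Ioc (1 / ((n : ℝ) + 1)) 1, 1 / a x :=
        setIntegral_congr_fun measurableSet_Ioc fun x hx =>
          Real.norm_of_nonneg (one_div_pos.2 (ha.pos x ((hpos n).trans hx.1))).le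
      rw [h2]; linarith
  have h3 := hint.lintegral_lt_top
  exact h3.ne hph

/-! ### The conformal embedding and displacements along timelike curves. -/

/-- The conformal embedding of the spacetime into the open future cone of Minkowski space. -/
def coneMap (a : ℝ → ℝ) (q : ℝ × Mink d) : Mink d := Real.exp (conformalTime a q.1) • q.2

theorem coneMap_mem_futureCone {q : ℝ × Mink d} (hq : q ∈ spacetime d) :
    coneMap a q ∈ futureCone d := by
  have h : ‖q.2.2‖ < q.2.1 := hyperbolicSpace_subset_futureCone hq.2
  simp only [futureCone, coneMap, mem_ofPred_eq, Prod.smul_fst, Prod.smul_snd, norm_smul,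
    Real.norm_of_nonneg (Real.exp_pos _).le, smul_eq_mul]
  exact mul_lt_mul_of_pos_left h (Real.exp_pos _)

theorem mink_coneMap_self {q : ℝ × Mink d} (hq : q ∈ spacetime d) :
    mink (coneMap a q) (coneMap a q) = -Real.exp (conformalTime a q.1) ^ 2 := by
  simp only [coneMap, mink_smul_left, mink_smul_right, hq.2.1]; ring

theorem neg_mink_coneMap {p : Mink d} (hp : p ∈ hyperbolicSpace d) {q : ℝ × Mink d}
    (hq : q ∈ spacetime d) :
    -mink p (coneMap a q) = Real.exp (conformalTime a q.1) * Real.cosh (radius p q.2) := by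
  rw [cosh_radius hp hq.2, coneMap, mink_smul_right]; ring

theorem IsFutureTimelikeOn.right_mem {γ : ℝ → ℝ × Mink d} {α β : ℝ}
    (h : IsFutureTimelikeOn a γ α β) : γ β ∈ spacetime d := by
  induction h with
  | smooth hlt hm => exact hm (right_mem_Icc.2 hlt.le)
  | concat _ _ h₁ h₂ => exact h₂

/-- A curve whose velocities lie in the open future cone has displacement in that cone. -/
theorem sub_mem_futureCone_of_hasDerivAt {Y Y' : ℝ → Mink d} {α β : ℝ} (hlt : α < β)
    (hc : ContinuousOn Y (Icc α β)) (hd : ∀ s ∈ Ioo α β, HasDerivAt Y (Y' s) s)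
    (hY : ∀ s ∈ Ioo α β, Y' s ∈ futureCone d) : Y β - Y α ∈ futureCone d := by
  -- The open cone is the intersection of these half-spaces, and each of the functionals increases
  -- strictly along the curve.
  have key : ∀ n : EuclideanSpace ℝ (Fin d), ‖n‖ ≤ 1 →
      0 < (Y β - Y α).1 - inner ℝ n (Y β - Y α).2 := by
    intro n hn
    have hmono : StrictMonoOn (fun s => (Y s).1 - inner ℝ n (Y s).2) (Icc α β) := by
      refine strictMonoOn_of_deriv_pos (convex_Icc _ _) ?_ fun s hs => ?_
      · exact hc.fst.sub (continuousOn_const.inner hc.snd)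
      · rw [interior_Icc] at hs
        have h1 := hd s hs
        have h2 : HasDerivAt (fun s => (Y s).1 - inner ℝ n (Y s).2)
            ((Y' s).1 - inner ℝ n (Y' s).2) s := by
          have h3 : HasDerivAt (fun s => (Y s).1) (Y' s).1 s :=
            h1.hasFDerivAt.fst.hasDerivAt.congr_deriv (by simp)
          have h4 : HasDerivAt (fun s => (Y s).2) (Y' s).2 s :=
            h1.hasFDerivAt.snd.hasDerivAt.congr_deriv (by simp)
          exact h3.sub ((innerSL ℝ n).hasFDerivAt.comp_hasDerivAt s h4)
        rw [h2.deriv]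
        have h4 : ‖(Y' s).2‖ < (Y' s).1 := hY s hs
        have h5 := real_inner_le_norm n (Y' s).2
        nlinarith [norm_nonneg (Y' s).2]
    have := hmono (left_mem_Icc.2 hlt.le) (right_mem_Icc.2 hlt.le) hlt
    simp only [Prod.fst_sub, Prod.snd_sub, inner_sub_right]
    simp only at this
    linarith
  set V := Y β - Y α
  show ‖V.2‖ < V.1
  by_cases h0 : V.2 = 0
  · have := key 0 (by simp)
    simpa [h0] using this
  · have h1 : ‖V.2‖ ≠ 0 := norm_ne_zero_iff.2 h0
    have := key (‖V.2‖⁻¹ • V.2) (by rw [norm_smul, norm_inv, norm_norm, inv_mul_cancel₀ h1])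
    rw [real_inner_smul_left, real_inner_self_eq_norm_sq, pow_two, inv_mul_cancel_left₀ h1] at this
    linarith

theorem hasDerivAt_coneMap (ha : IsScaleFactor a) {γ : ℝ → ℝ × Mink d} {v : ℝ × Mink d} {s : ℝ}
    (hs : 0 < (γ s).1) (hγ : HasDerivAt γ v s) :
    HasDerivAt (fun s => coneMap a (γ s)) (Real.exp (conformalTime a (γ s).1) •
      (v.2 + (v.1 / a (γ s).1) • (γ s).2)) s := by
  have h1 := ((hasDerivAt_conformalTime ha hs).comp s hγ.fst).exp.smul hγ.snd
  refine h1.congr_deriv ?_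
  simp only [Function.comp_apply, smul_add, smul_smul]
  congr 2
  ring

theorem hasDerivAt_mink_self {x : ℝ → Mink d} {v : Mink d} {s : ℝ} (h : HasDerivAt x v s) :
    HasDerivAt (fun s => mink (x s) (x s)) (2 * mink (x s) v) s := by
  have hf : HasDerivAt (fun s => (x s).1) v.1 s :=
    h.hasFDerivAt.fst.hasDerivAt.congr_deriv (by simp)
  have hg : HasDerivAt (fun s => (x s).2) v.2 s :=
    h.hasFDerivAt.snd.hasDerivAt.congr_deriv (by simp)
  have h1 := ((hf.mul hf).neg).add (hg.inner ℝ hg)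
  refine h1.congr_deriv ?_
  rw [real_inner_comm (x s).2 v.2, mink]
  ring

/-- Future directed timelike tangent vectors are mapped to the open future cone. -/
theorem coneMap_velocity_mem (ha : IsScaleFactor a) {q v : ℝ × Mink d} (hq : q ∈ spacetime d)
    (hv : IsFutureTimelike a q v) (hort : mink q.2 v.2 = 0) :
    Real.exp (conformalTime a q.1) • (v.2 + (v.1 / a q.1) • q.2) ∈ futureCone d := by
  have hA := ha.pos _ hq.1
  have he := Real.exp_pos (conformalTime a q.1)
  obtain ⟨h1, h2⟩ := hv
  have hlt : mink v.2 v.2 < (v.1 / a q.1) ^ 2 := by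
    rw [metric] at h1
    rw [div_pow, lt_div_iff₀ (by positivity)]
    linarith
  -- The square of the image vector is `e^(2τ) (⟨v, v⟩ - (v⁰ / a)²)`, negative by `hlt`; pairing
  -- with the position selects the future half.
  refine mem_futureCone_of_mink_neg (hyperbolicSpace_subset_futureCone hq.2) ?_ ?_
  · simp only [mink_smul_left, mink_smul_right, mink_add_left, mink_add_right, hq.2.1, hort,
      mink_comm v.2 q.2]
    have : Real.exp (conformalTime a q.1) ^ 2 * (mink v.2 v.2 - (v.1 / a q.1) ^ 2) < 0 :=
      mul_neg_of_pos_of_neg (by positivity) (by linarith)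
    linarith
  · simp only [mink_smul_right, mink_add_right, hq.2.1, hort]
    refine mul_neg_of_pos_of_neg he ?_
    have : 0 < v.1 / a q.1 := by positivity
    linarith

theorem IsFutureTimelikeOn.coneMap_sub_mem (ha : IsScaleFactor a) {γ : ℝ → ℝ × Mink d} {α β : ℝ}
    (h : IsFutureTimelikeOn a γ α β) : coneMap a (γ β) - coneMap a (γ α) ∈ futureCone d := by
  induction h with
  | @smooth α β hlt hmaps hsmooth htl =>
    have hd : ∀ s ∈ Ioo α β, HasDerivAt γ (derivWithin γ (Icc α β) s) s := fun s hs =>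
      ((hsmooth.differentiableOn (by simp)) s
        (Ioo_subset_Icc_self hs)).hasDerivWithinAt.hasDerivAt (Icc_mem_nhds hs.1 hs.2)
    have hc := hsmooth.continuousOn
    refine sub_mem_futureCone_of_hasDerivAt (Y := fun s => coneMap a (γ s)) hlt ?_
      (fun s hs => hasDerivAt_coneMap ha (hmaps (Ioo_subset_Icc_self hs)).1 (hd s hs))
      fun s hs => coneMap_velocity_mem ha (hmaps (Ioo_subset_Icc_self hs))
        (htl s (Ioo_subset_Icc_self hs)) ?_
    · exact (Real.continuous_exp.comp_continuousOn ((continuousOn_conformalTime ha).comp hc.fst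
        fun s hs => (hmaps hs).1)).smul hc.snd
    -- Differentiating the constraint `⟨x, x⟩ = -1` makes the velocity orthogonal to the position.
    · have h1 := hasDerivAt_mink_self (hd s hs).snd
      have h2 : HasDerivAt (fun s => mink (γ s).2 (γ s).2) 0 s := by
        refine (hasDerivAt_const s (-1 : ℝ)).congr_of_eventuallyEq ?_
        filter_upwards [Icc_mem_nhds hs.1 hs.2] with r hr using (hmaps hr).2.1
      have := h1.unique h2
      linarith
  | concat _ _ h₁ h₂ =>
    have := add_mem_futureCone h₂ (futureCone_subset_causalCone h₁)
    rwa [sub_add_sub_cancel] at this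

/-! ### Construction of timelike curves. -/

/-- A nonnegative number below the integral of `f` is the increment of a smooth function whose
derivative is smaller than `f` in absolute value. -/
theorem exists_contDiff_abs_deriv_lt {f : ℝ → ℝ} {t t' D : ℝ} (hlt : t < t')
    (hf : ContinuousOn f (Icc t t')) (hpos : ∀ s ∈ Icc t t', 0 < f s) (hD : 0 ≤ D)
    (hDf : D < ∫ s in t..t', f s) :
    ∃ ρ : ℝ → ℝ, ContDiff ℝ ∞ ρ ∧ ρ t = 0 ∧ ρ t' = D ∧ ∀ s ∈ Icc t t', |deriv ρ s| < f s := by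
  set T := ∫ s in t..t', f s with hT
  have hTpos : 0 < T := hD.trans_lt hDf
  -- `c f` has integral `D` but is only continuous. A polynomial `ε`-close to it, corrected by a
  -- constant `κ` with `|κ| ≤ ε` that restores the integral, is off by less than `2ε`, and `3ε ≤ (1
  -- - c) f`.
  set c := D / T with hc
  have hc0 : 0 ≤ c := by positivity
  have hc1 : c < 1 := (div_lt_one hTpos).2 hDf
  obtain ⟨s₀, hs₀, hmin⟩ := isCompact_Icc.exists_isMinOn (nonempty_Icc.2 hlt.le) hf
  set ε := (1 - c) * f s₀ / 3 with hε
  have hε0 : 0 < ε := div_pos (mul_pos (by linarith) (hpos _ hs₀)) three_pos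
  obtain ⟨P, hP⟩ := exists_polynomial_near_of_continuousOn t t' (fun s => c * f s)
    (continuousOn_const.mul hf) ε hε0
  have hlen : 0 < t' - t := by linarith
  set κ := (D - ∫ s in t..t', P.eval s) / (t' - t) with hκ
  have hfi : IntervalIntegrable f volume t t' := by
    apply ContinuousOn.intervalIntegrable; rwa [uIcc_of_le hlt.le]
  have hPi : ∀ r r', IntervalIntegrable (fun s => P.eval s) volume r r' := fun r r' =>
    P.continuous.intervalIntegrable _ _
  have hκε : |κ| ≤ ε := by
    have h1 : D - ∫ s in t..t', P.eval s = ∫ s in t..t', (c * f s - P.eval s) := by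
      rw [intervalIntegral.integral_sub (hfi.const_mul c) (hPi _ _),
        intervalIntegral.integral_const_mul, ← hT, hc, div_mul_cancel₀ _ hTpos.ne']
    have h2 : ‖∫ s in t..t', (c * f s - P.eval s)‖ ≤ ε * |t' - t| := by
      refine intervalIntegral.norm_integral_le_of_norm_le_const fun s hs => ?_
      rw [uIoc_of_le hlt.le] at hs
      rw [Real.norm_eq_abs, abs_sub_comm]
      exact (hP s (Ioc_subset_Icc_self hs)).le
    rw [hκ, h1, abs_div, div_le_iff₀ (abs_pos.2 hlen.ne')]
    exact h2
  have hder : ∀ s, HasDerivAt (fun s => ∫ x in t..s, (P.eval x + κ)) (P.eval s + κ) s := fun s =>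
    (P.continuous.add continuous_const).integral_hasStrictDerivAt t s |>.hasDerivAt
  refine ⟨fun s => ∫ x in t..s, (P.eval x + κ), ?_, by simp, ?_, fun s hs => ?_⟩
  · rw [contDiff_infty_iff_deriv]
    refine ⟨fun s => (hder s).differentiableAt, ?_⟩
    rw [show deriv (fun s => ∫ x in t..s, (P.eval x + κ)) = fun s => P.eval s + κ from
      funext fun s => (hder s).deriv]
    have hPs : ContDiff ℝ ∞ fun s => P.eval s := by simpa using P.contDiff_aeval (𝕜 := ℝ) ∞
    exact hPs.add contDiff_const
  · simp only
    rw [intervalIntegral.integral_add (hPi _ _) intervalIntegrable_const,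
      intervalIntegral.integral_const, smul_eq_mul, hκ, mul_div_cancel₀ _ hlen.ne']
    ring
  · rw [(hder s).deriv]
    have h1 := hP s hs
    have h2 : f s₀ ≤ f s := hmin hs
    have h3 : 3 * ε ≤ (1 - c) * f s := by
      rw [hε]; nlinarith
    have h4 := mul_nonneg hc0 (hpos s hs).le
    rw [abs_lt] at h1 ⊢
    rw [abs_le] at hκε
    constructor <;> linarith

theorem hasDerivAt_polar {ρ : ℝ → ℝ} {ρ' s : ℝ} (x w : Mink d) (h : HasDerivAt ρ ρ' s) :
    HasDerivAt (fun s => polar x (ρ s) w)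
      (ρ' • (Real.sinh (ρ s) • x + Real.cosh (ρ s) • w)) s := by
  have h1 := (h.cosh.smul_const x).add (h.sinh.smul_const w)
  refine h1.congr_deriv ?_
  rw [smul_add, smul_smul, smul_smul, mul_comm ρ', mul_comm ρ']

/-- Points which are connected by a curve `t ↦ (t, x t)` of subluminal speed. -/
theorem mem_timelikeFuture_of_graph {x v : ℝ → Mink d} {t t' : ℝ} (ht : 0 < t) (hlt : t < t')
    (hx : ∀ s ∈ Icc t t', x s ∈ hyperbolicSpace d) (hs : ContDiff ℝ ∞ x)
    (hd : ∀ s ∈ Icc t t', HasDerivAt x (v s) s)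
    (hv : ∀ s ∈ Icc t t', a s ^ 2 * mink (v s) (v s) < 1) :
    (t', x t') ∈ timelikeFuture a (t, x t) := by
  refine ⟨fun s => (s, x s), t, t', .smooth hlt (fun s hs' => ⟨ht.trans_le hs'.1, hx s hs'⟩)
    (contDiff_id.prodMk hs).contDiffOn fun s hs' => ?_, rfl, rfl⟩
  have h1 : HasDerivAt (fun s => (s, x s)) (1, v s) s := (hasDerivAt_id s).prodMk (hd s hs')
  rw [h1.hasDerivWithinAt.derivWithin (uniqueDiffOn_Icc hlt s hs')]
  refine ⟨?_, one_pos⟩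
  simp only [metric]
  linarith [hv s hs']

/-- The cone condition amounts to `t < t'` and hyperbolic distance less than `τ(t') - τ(t)`. The
geodesic from `x` to `y` can then be traversed in time `[t, t']` with speed below `1 / a`. -/
theorem mem_timelikeFuture (ha : IsScaleFactor a) {q q' : ℝ × Mink d} (hq : q ∈ spacetime d)
    (hq' : q' ∈ spacetime d) (h : coneMap a q' - coneMap a q ∈ futureCone d) :
    q' ∈ timelikeFuture a q := by
  obtain ⟨t, x⟩ := q
  obtain ⟨t', y⟩ := q'
  have ht : 0 < t := hq.1
  have ht' : 0 < t' := hq'.1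
  have hx : x ∈ hyperbolicSpace d := hq.2
  have hy : y ∈ hyperbolicSpace d := hq'.2
  have h1 := mink_self_neg_of_mem_futureCone h
  have h2 := mink_neg (coneMap_mem_futureCone (a := a) hq) h
  have hq1 := mink_coneMap_self (a := a) hq
  have hq2 := mink_coneMap_self (a := a) hq'
  have hxy : mink (coneMap a (t, x)) (coneMap a (t', y)) =
      -(Real.exp (conformalTime a t) * Real.exp (conformalTime a t') *
        Real.cosh (radius x y)) := by
    rw [cosh_radius hx hy]
    simp only [coneMap, mink_smul_left, mink_smul_right]; ring
  simp only [mink_sub_left, mink_sub_right] at h1 h2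
  rw [mink_comm (coneMap a (t', y)) (coneMap a (t, x)), hq1, hq2, hxy] at h1
  rw [hq1, hxy] at h2
  simp only at h1 h2
  have he := Real.exp_pos (conformalTime a t)
  have he' := Real.exp_pos (conformalTime a t')
  -- Write `e`, `e'` for the exponentials and `r` for the distance: `h2` reads `e < e' cosh r` and
  -- `h1` reads `2 e e' cosh r < e² + e'²`, so `2 e² < e² + e'²`.
  have hexp : Real.exp (conformalTime a t) < Real.exp (conformalTime a t') := by
    nlinarith
  have htau : conformalTime a t < conformalTime a t' := Real.exp_lt_exp.1 hexp
  have hlt : t < t' := (strictMonoOn_conformalTime ha).lt_iff_lt ht ht' |>.1 htau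
  have hcosh : Real.cosh (radius x y) < Real.cosh (conformalTime a t' - conformalTime a t) := by
    rw [Real.cosh_eq (_ - _), neg_sub, Real.exp_sub, Real.exp_sub]
    rw [div_add_div _ _ he.ne' he'.ne', div_div, lt_div_iff₀ (by positivity)]
    nlinarith
  have hrad : radius x y < ∫ s in t..t', 1 / a s := by
    rw [Real.cosh_lt_cosh, abs_of_nonneg (radius_nonneg hx hy), abs_of_pos (by linarith),
      conformalTime_sub ha ht ht'] at hcosh
    exact hcosh
  -- No direction is defined when the points coincide; a curve at rest serves there.
  by_cases hne : x = y
  · subst hne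
    refine mem_timelikeFuture_of_graph (x := fun _ => x) (v := fun _ => 0) ht hlt (fun _ _ => hx)
      contDiff_const (fun s _ => hasDerivAt_const s x) fun _ _ => ?_
    simp [mink]
  · obtain ⟨ρ, hρ, h0, hD, hρ'⟩ := exists_contDiff_abs_deriv_lt hlt
      (ha.continuousOn_inv.mono fun s hs => ht.trans_le hs.1)
      (fun s hs => one_div_pos.2 (ha.pos s (ht.trans_le hs.1))) (radius_nonneg hx hy) hrad
    have hw := angle_mem_unitTangentSphere hx hy hne
    have := mem_timelikeFuture_of_graph (a := a) (x := fun s => polar x (ρ s) (angle x y)) ht hlt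
      (fun s _ => polar_mem_hyperbolicSpace hx hw _)
      (by unfold polar; exact (hρ.cosh.smul contDiff_const).add (hρ.sinh.smul contDiff_const))
      (fun s _ => hasDerivAt_polar x _ (hρ.differentiable (by simp) s).hasDerivAt) fun s hs => ?_
    · simp only [h0, hD, polar_radius_angle hx hy hne] at this
      simpa [polar] using this
    · have hA := ha.pos s (ht.trans_le hs.1)
      have h5 := hρ' s hs
      rw [lt_div_iff₀ hA] at h5
      simp only [mink_smul_left, mink_smul_right, mink_add_left, mink_add_right, hx.1, hw.1, hw.2,
        mink_comm (angle x y) x]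
      have h6 : (|deriv ρ s| * a s) ^ 2 < 1 := by
        rw [sq_lt_one_iff_abs_lt_one, abs_of_nonneg (by positivity)]; exact h5
      rw [mul_pow, sq_abs] at h6
      have h7 := Real.cosh_sq (ρ s)
      linear_combination h6 + a s ^ 2 * deriv ρ s ^ 2 * h7

theorem mem_timelikeFuture_iff (ha : IsScaleFactor a) {q q' : ℝ × Mink d}
    (hq : q ∈ spacetime d) :
    q' ∈ timelikeFuture a q ↔
      q' ∈ spacetime d ∧ coneMap a q' - coneMap a q ∈ futureCone d := by
  refine ⟨?_, fun h => mem_timelikeFuture ha hq h.1 h.2⟩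
  rintro ⟨σ, α, β, hσ, rfl, rfl⟩
  exact ⟨hσ.right_mem, hσ.coneMap_sub_mem ha⟩

/-! ### Past endpoints of inextendible curves. -/

theorem IsPastInextendibleTimelike.mem_spacetime {γ : ℝ → ℝ × Mink d}
    (hγ : IsPastInextendibleTimelike a γ) {s : ℝ} (hs : s ∈ Ioc (0 : ℝ) 1) : γ s ∈ spacetime d :=
  (hγ.timelike (s / 2) s (by linarith [hs.1]) (by linarith [hs.1]) hs.2).right_mem

theorem IsPastInextendibleTimelike.eventually_mem_spacetime {γ : ℝ → ℝ × Mink d}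
    (hγ : IsPastInextendibleTimelike a γ) : ∀ᶠ s in 𝓝[>] (0 : ℝ), γ s ∈ spacetime d :=
  mem_of_superset (Ioc_mem_nhdsGT one_pos) fun _ hs => hγ.mem_spacetime hs

/-- A curve which is increasing for the order defined by the future cone, and bounded below by
the apex, converges towards the past. -/
theorem exists_tendsto_of_sub_mem_futureCone {Y : ℝ → Mink d}
    (hY : ∀ s ∈ Ioc (0 : ℝ) 1, Y s ∈ futureCone d)
    (hsub : ∀ s s', 0 < s → s < s' → s' ≤ 1 → Y s' - Y s ∈ futureCone d) :
    ∃ Y₀, Tendsto Y (𝓝[>] 0) (𝓝 Y₀) := by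
  have hlt : ∀ s s', 0 < s → s < s' → s' ≤ 1 → ‖(Y s').2 - (Y s).2‖ < (Y s').1 - (Y s).1 :=
    hsub
  have hfst : ∃ l, Tendsto (fun s => (Y s).1) (𝓝[>] 0) (𝓝 l) := by
    have hmono : MonotoneOn (fun s => (Y s).1) (Ioc 0 1) := by
      intro s hs s' hs' hss
      rcases hss.eq_or_lt with rfl | h
      · exact le_rfl
      · linarith [hlt s s' hs.1 h hs'.2, norm_nonneg ((Y s').2 - (Y s).2)]
    have hbdd : BddBelow ((fun s => (Y s).1) '' Ioo 0 1) := by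
      refine ⟨0, ?_⟩
      rintro _ ⟨s, hs, rfl⟩
      exact (norm_nonneg _).trans (le_of_lt (hY s (Ioo_subset_Ioc_self hs)))
    exact ⟨_, (hmono.mono Ioo_subset_Ioc_self).tendsto_nhdsWithin_Ioo_right
      (nonempty_Ioo.2 one_pos) hbdd⟩
  obtain ⟨l, hl⟩ := hfst
  have hc : Cauchy (map (fun s => (Y s).1) (𝓝[>] 0)) := hl.cauchy_map
  refine cauchy_map_iff_exists_tendsto.1 (Metric.cauchy_iff.2 ⟨inferInstance, fun ε hε => ?_⟩)
  obtain ⟨t, ht, htε⟩ := (Metric.cauchy_iff.1 hc).2 ε hε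
  refine ⟨Y '' ((fun s => (Y s).1) ⁻¹' t ∩ Ioc 0 1),
    image_mem_map (inter_mem ht (Ioc_mem_nhdsGT one_pos)), ?_⟩
  -- Spatial increments are dominated by time increments, so the Cauchy property passes from the
  -- time component to the whole curve.
  have key : ∀ s ∈ Ioc (0 : ℝ) 1, ∀ s' ∈ Ioc (0 : ℝ) 1, s < s' → dist (Y s) (Y s') ≤
      dist (Y s).1 (Y s').1 := by
    intro s hs s' hs' h
    rw [Prod.dist_eq, dist_eq_norm (Y s).2, norm_sub_rev]
    refine max_le le_rfl ((hlt s s' hs.1 h hs'.2).le.trans ?_)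
    rw [Real.dist_eq, abs_sub_comm]
    exact le_abs_self _
  rintro _ ⟨s, ⟨hs1, hs⟩, rfl⟩ _ ⟨s', ⟨hs1', hs'⟩, rfl⟩
  have hd := htε _ hs1 _ hs1'
  rcases lt_trichotomy s s' with h | rfl | h
  · exact (key s hs s' hs' h).trans_lt hd
  · simpa using hε
  · rw [dist_comm] at hd ⊢
    exact (key s' hs' s hs h).trans_lt hd

/-- The past endpoint, on the cone, of a past inextendible timelike curve. -/
theorem IsPastInextendibleTimelike.exists_tendsto_coneMap (ha : IsScaleFactor a)
    {γ : ℝ → ℝ × Mink d} (hγ : IsPastInextendibleTimelike a γ) :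
    ∃ Y₀, Tendsto (fun s => coneMap a (γ s)) (𝓝[>] 0) (𝓝 Y₀) :=
  exists_tendsto_of_sub_mem_futureCone (fun _ hs => coneMap_mem_futureCone (hγ.mem_spacetime hs))
    fun s s' hs hss hs' => (hγ.timelike s s' hs hss hs').coneMap_sub_mem ha

theorem IsPastInextendibleTimelike.limit_mem_causalCone {γ : ℝ → ℝ × Mink d}
    (hγ : IsPastInextendibleTimelike a γ) {Y₀ : Mink d}
    (hY : Tendsto (fun s => coneMap a (γ s)) (𝓝[>] 0) (𝓝 Y₀)) : Y₀ ∈ causalCone d :=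
  isClosed_causalCone.mem_of_tendsto hY <| hγ.eventually_mem_spacetime.mono fun _ hs =>
    futureCone_subset_causalCone (coneMap_mem_futureCone hs)

theorem tendsto_mink {Y Z : ℝ → Mink d} {Y₀ Z₀ : Mink d} {l : Filter ℝ} (hY : Tendsto Y l (𝓝 Y₀))
    (hZ : Tendsto Z l (𝓝 Z₀)) : Tendsto (fun s => mink (Y s) (Z s)) l (𝓝 (mink Y₀ Z₀)) :=
  (continuous_mink.tendsto (Y₀, Z₀)).comp (hY.prodMk_nhds hZ)

theorem IsPastInextendibleTimelike.tendsto_exp_sq {γ : ℝ → ℝ × Mink d}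
    (hγ : IsPastInextendibleTimelike a γ) {Y₀ : Mink d}
    (hY : Tendsto (fun s => coneMap a (γ s)) (𝓝[>] 0) (𝓝 Y₀)) :
    Tendsto (fun s => Real.exp (conformalTime a (γ s).1) ^ 2) (𝓝[>] 0) (𝓝 (-mink Y₀ Y₀)) := by
  refine (tendsto_mink hY hY).neg.congr' ?_
  filter_upwards [hγ.eventually_mem_spacetime] with s hs
  rw [mink_coneMap_self hs, neg_neg]

theorem IsPastInextendibleTimelike.tendsto_exp_mul_cosh {p : Mink d} (hp : p ∈ hyperbolicSpace d)
    {γ : ℝ → ℝ × Mink d} (hγ : IsPastInextendibleTimelike a γ) {Y₀ : Mink d}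
    (hY : Tendsto (fun s => coneMap a (γ s)) (𝓝[>] 0) (𝓝 Y₀)) :
    Tendsto (fun s => Real.exp (conformalTime a (γ s).1) * Real.cosh (radius p (γ s).2)) (𝓝[>] 0)
      (𝓝 (-mink p Y₀)) := by
  refine (tendsto_mink tendsto_const_nhds hY).neg.congr' ?_
  filter_upwards [hγ.eventually_mem_spacetime] with s hs
  rw [neg_mink_coneMap hp hs]

/-- Convergence of conformal time forces convergence of time to a positive value. -/
theorem exists_tendsto_of_conformalTime (ha : IsScaleFactor a) (hph : NoParticleHorizons a)
    {t : ℝ → ℝ} {l : Filter ℝ} [l.NeBot] (ht : ∀ᶠ s in l, 0 < t s) {L t₁ : ℝ} (ht₁ : 0 < t₁)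
    (hL : Tendsto (fun s => conformalTime a (t s)) l (𝓝 L)) (hle : L ≤ conformalTime a t₁) :
    ∃ t₀, 0 < t₀ ∧ conformalTime a t₀ = L ∧ Tendsto t l (𝓝 t₀) := by
  have hmono := strictMonoOn_conformalTime ha
  -- Absence of particle horizons enters here: otherwise `τ` could converge while `t → 0`. The bound
  -- `hle` excludes escape to `t → ∞`, since `τ` may be bounded above.
  obtain ⟨t₂, ht₂, hlt⟩ := exists_conformalTime_lt ha hph L
  have h21 : t₂ ≤ t₁ := ((hmono.lt_iff_lt ht₂ ht₁).1 (hlt.trans_le hle)).le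
  obtain ⟨t₀, ht₀, h₀⟩ := intermediate_value_Icc h21
    ((continuousOn_conformalTime ha).mono fun s hs => ht₂.trans_le hs.1) ⟨hlt.le, hle⟩
  have hpos : 0 < t₀ := ht₂.trans_le ht₀.1
  refine ⟨t₀, hpos, h₀, tendsto_order.2 ⟨fun b hb => ?_, fun b hb => ?_⟩⟩
  · by_cases hb0 : 0 < b
    · filter_upwards [ht, hL.eventually_const_lt (h₀ ▸ hmono hb0 hpos hb)] with s hs1 hs2
      exact (hmono.lt_iff_lt hb0 hs1).1 hs2
    · filter_upwards [ht] with s hs using (not_lt.1 hb0).trans_lt hs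
  · have hb0 : 0 < b := hpos.trans hb
    filter_upwards [ht, hL.eventually_lt_const (h₀ ▸ hmono hpos hb0 hb)] with s hs1 hs2
    exact (hmono.lt_iff_lt hs1 hb0).1 hs2

/-- The past endpoint of a past inextendible curve lies on the boundary of the cone. -/
theorem IsPastInextendibleTimelike.mink_limit_eq_zero (ha : IsScaleFactor a)
    (hph : NoParticleHorizons a) {γ : ℝ → ℝ × Mink d} (hγ : IsPastInextendibleTimelike a γ)
    {Y₀ : Mink d} (hY : Tendsto (fun s => coneMap a (γ s)) (𝓝[>] 0) (𝓝 Y₀)) :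
    mink Y₀ Y₀ = 0 := by
  have hcausal := hγ.limit_mem_causalCone hY
  by_contra hne
  have hneg : 0 < -mink Y₀ Y₀ := by
    have := (mink_self_nonpos_of_mem_causalCone hcausal).lt_of_ne hne
    linarith
  have hsq := hγ.tendsto_exp_sq hY
  have htau : Tendsto (fun s => conformalTime a (γ s).1) (𝓝[>] 0)
      (𝓝 (Real.log (-mink Y₀ Y₀) / 2)) := by
    refine ((hsq.log hneg.ne').div_const 2).congr fun s => ?_
    rw [Real.log_pow, Real.log_exp]; push_cast; ring
  -- Keeps the limit of `τ` below an attained value, so that `t` converges too.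
  have hev : ∀ᶠ s in 𝓝[>] (0 : ℝ), conformalTime a (γ s).1 ≤ conformalTime a (γ 1).1 := by
    filter_upwards [Ioo_mem_nhdsGT (zero_lt_one' ℝ)] with s hs
    have hs' : γ s ∈ spacetime d := hγ.mem_spacetime (Ioo_subset_Ioc_self hs)
    have h1' : γ 1 ∈ spacetime d := hγ.mem_spacetime ⟨one_pos, le_rfl⟩
    have hV := (hγ.timelike s 1 hs.1 hs.2 le_rfl).coneMap_sub_mem ha
    have hW := coneMap_mem_futureCone (a := a) hs'
    have h2 := mink_neg hW hV
    have h3 := mink_self_neg_of_mem_futureCone hV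
    have h4 := mink_coneMap_self (a := a) hs'
    have h5 := mink_coneMap_self (a := a) h1'
    simp only [mink_sub_left, mink_sub_right, mink_comm (coneMap a (γ 1)) (coneMap a (γ s))]
      at h2 h3
    exact Real.exp_le_exp.1 (le_of_lt (lt_of_pow_lt_pow_left₀ 2 (Real.exp_pos _).le (by linarith)))
  obtain ⟨t₀, ht₀, hτ₀, ht⟩ := exists_tendsto_of_conformalTime ha hph
    (hγ.eventually_mem_spacetime.mono fun s hs => hs.1) (hγ.mem_spacetime ⟨one_pos, le_rfl⟩).1
    htau (le_of_tendsto htau hev)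
  have hx : Tendsto (fun s => (γ s).2) (𝓝[>] 0) (𝓝 (Real.exp (-conformalTime a t₀) • Y₀)) := by
    rw [hτ₀]
    refine ((htau.neg.rexp).smul hY).congr fun s => ?_
    rw [coneMap, smul_smul, ← Real.exp_add, neg_add_cancel, Real.exp_zero, one_smul]
  refine hγ.inextendible ⟨(t₀, Real.exp (-conformalTime a t₀) • Y₀), ⟨ht₀, ?_, ?_⟩,
    ht.prodMk_nhds hx⟩
  · refine tendsto_nhds_unique (tendsto_mink hx hx) (tendsto_const_nhds.congr' ?_)
    filter_upwards [hγ.eventually_mem_spacetime] with s hs using hs.2.1.symm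
  · refine mul_pos (Real.exp_pos _) (lt_of_le_of_ne ((norm_nonneg _).trans hcausal) fun h => ?_)
    have := eq_zero_of_mem_causalCone hcausal h.ge
    simp [this, mink] at hneg

/-! ### Polar coordinates near the past endpoint. -/

theorem exp_nullCoord (p : Mink d) (q : ℝ × Mink d) :
    Real.exp (nullCoord a p q) =
      Real.exp (conformalTime a q.1) * Real.cosh (radius p q.2) +
        Real.exp (conformalTime a q.1) * Real.sinh (radius p q.2) := by
  rw [nullCoord, add_comm, Real.exp_add, ← mul_add, Real.cosh_add_sinh]

theorem IsPastInextendibleTimelike.tendsto_nullCoord_atBot {p : Mink d}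
    (hp : p ∈ hyperbolicSpace d) {γ : ℝ → ℝ × Mink d} (hγ : IsPastInextendibleTimelike a γ)
    (hY : Tendsto (fun s => coneMap a (γ s)) (𝓝[>] 0) (𝓝 0)) :
    Tendsto (fun s => nullCoord a p (γ s)) (𝓝[>] 0) atBot := by
  have h := (hγ.tendsto_exp_mul_cosh hp hY).const_mul 2
  rw [← Real.tendsto_exp_comp_nhds_zero]
  refine squeeze_zero (fun s => (Real.exp_pos _).le) (fun s => ?_)
    (by simpa [mink] using h)
  rw [exp_nullCoord]
  nlinarith [Real.exp_pos (conformalTime a (γ s).1), Real.sinh_lt_cosh (radius p (γ s).2)]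

/-- Since `sinh r ≥ 0`, the product `-⟨p, Y⟩ = e^τ cosh r` is at most `e^u`, which tends to `0`; a
causal vector whose product with the timelike `p` vanishes is zero. -/
theorem IsPastInextendibleTimelike.tendsto_coneMap_zero {p : Mink d}
    (hp : p ∈ hyperbolicSpace d) {γ : ℝ → ℝ × Mink d} (hγ : IsPastInextendibleTimelike a γ)
    {Y₀ : Mink d} (hY : Tendsto (fun s => coneMap a (γ s)) (𝓝[>] 0) (𝓝 Y₀))
    (hu : Tendsto (fun s => nullCoord a p (γ s)) (𝓝[>] 0) atBot) : Y₀ = 0 := by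
  have h0 : -mink p Y₀ ≤ 0 := by
    refine le_of_tendsto_of_tendsto (hγ.tendsto_exp_mul_cosh hp hY)
      (Real.tendsto_exp_atBot.comp hu) ?_
    filter_upwards [hγ.eventually_mem_spacetime] with s hs
    rw [Function.comp_apply, exp_nullCoord]
    have := Real.sinh_nonneg_iff.2 (radius_nonneg hp hs.2)
    have := mul_nonneg (Real.exp_pos (conformalTime a (γ s).1)).le this
    linarith
  have hcausal := hγ.limit_mem_causalCone hY
  have h1 : ‖p.2‖ < p.1 := hyperbolicSpace_subset_futureCone hp
  have h2 := mul_le_neg_mink (V := p) hcausal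
  refine eq_zero_of_mem_causalCone hcausal ?_
  by_contra! h3
  nlinarith

/-- The asymptotics of the polar coordinates along a curve whose endpoint is a null vector. -/
theorem IsPastInextendibleTimelike.tendsto_of_null {p : Mink d}
    (hp : p ∈ hyperbolicSpace d) {γ : ℝ → ℝ × Mink d} (hγ : IsPastInextendibleTimelike a γ)
    {Y₀ : Mink d} (hY : Tendsto (fun s => coneMap a (γ s)) (𝓝[>] 0) (𝓝 Y₀))
    (hnull : mink Y₀ Y₀ = 0) (hc : 0 < -mink p Y₀) :
    Tendsto (fun s => nullCoord a p (γ s)) (𝓝[>] 0) (𝓝 (Real.log (2 * -mink p Y₀))) ∧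
      Tendsto (fun s => radius p (γ s).2) (𝓝[>] 0) atTop ∧
      Tendsto (fun s => angle p (γ s).2) (𝓝[>] 0) (𝓝 ((-mink p Y₀)⁻¹ • Y₀ - p)) := by
  set c := -mink p Y₀
  have hcosh := hγ.tendsto_exp_mul_cosh hp hY
  have hsq := hγ.tendsto_exp_sq hY
  rw [hnull, neg_zero] at hsq
  -- As `e^(2τ) → 0`, the identity `sinh² = cosh² - 1` gives `e^τ sinh r` the same limit as `e^τ
  -- cosh r`; hence `e^u → 2c`.
  have hsinh : Tendsto (fun s => Real.exp (conformalTime a (γ s).1) *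
      Real.sinh (radius p (γ s).2)) (𝓝[>] 0) (𝓝 c) := by
    have h1 := ((hcosh.pow 2).sub hsq).sqrt
    rw [sub_zero, Real.sqrt_sq hc.le] at h1
    refine h1.congr' ?_
    filter_upwards [hγ.eventually_mem_spacetime] with s hs
    have h2 := Real.sinh_nonneg_iff.2 (radius_nonneg hp hs.2)
    rw [Real.sqrt_eq_iff_eq_sq ?_ (by positivity), mul_pow, mul_pow, Real.cosh_sq]
    · ring
    · rw [mul_pow, Real.cosh_sq]
      nlinarith [mul_nonneg (sq_nonneg (Real.exp (conformalTime a (γ s).1)))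
        (sq_nonneg (Real.sinh (radius p (γ s).2)))]
  have hu := hcosh.add hsinh
  rw [← two_mul] at hu
  have hu' : Tendsto (fun s => nullCoord a p (γ s)) (𝓝[>] 0) (𝓝 (Real.log (2 * c))) :=
    (hu.log (by positivity)).congr fun s => by rw [← exp_nullCoord, Real.log_exp]
  refine ⟨hu', ?_, ?_⟩
  -- `τ → -∞` while `u` converges, so `r = u - τ → ∞`.
  · have htau : Tendsto (fun s => 2 * conformalTime a (γ s).1) (𝓝[>] 0) atBot := by
      rw [← Real.tendsto_exp_comp_nhds_zero]
      refine hsq.congr fun s => ?_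
      rw [two_mul, Real.exp_add, pow_two]
    have htau' := htau.const_mul_atBot (r := 1 / 2) (by norm_num)
    refine (hu'.add_atTop (tendsto_neg_atBot_atTop.comp htau')).congr fun s => ?_
    simp only [nullCoord, Function.comp_apply]; ring
  -- Scaling by `e^τ` writes the angle as `(e^τ sinh r)⁻¹ (Y - e^τ cosh r p)`, in which every factor
  -- converges.
  · have h1 := (hsinh.inv₀ hc.ne').smul (hY.sub (hcosh.smul_const p))
    have h2 : c⁻¹ • (Y₀ - c • p) = c⁻¹ • Y₀ - p := by
      rw [smul_sub, smul_smul, inv_mul_cancel₀ hc.ne', one_smul]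
    rw [h2] at h1
    refine h1.congr fun s => ?_
    have he := (Real.exp_pos (conformalTime a (γ s).1)).ne'
    rw [angle, coneMap, mul_smul, ← smul_sub, smul_smul, mul_inv_rev, mul_assoc,
      inv_mul_cancel₀ he, mul_one]

theorem sub_mem_unitTangentSphere {p Y₀ : Mink d} (hp : p ∈ hyperbolicSpace d)
    (hnull : mink Y₀ Y₀ = 0) (hc : 0 < -mink p Y₀) :
    (-mink p Y₀)⁻¹ • Y₀ - p ∈ unitTangentSphere p := by
  have hc' : mink p Y₀ ≠ 0 := by linarith
  constructor
  · rw [mink_sub_right, mink_smul_right, hp.1]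
    field_simp; ring
  · simp only [mink_sub_right, mink_smul_right, mink_sub_left, mink_smul_left, hp.1, hnull,
      mink_comm Y₀ p]
    field_simp; ring

theorem neg_mink_pos_of_ne_zero {p Y₀ : Mink d} (hp : p ∈ hyperbolicSpace d)
    (hY : Y₀ ∈ causalCone d) (hne : Y₀ ≠ 0) : 0 < -mink p Y₀ := by
  have h1 : ‖p.2‖ < p.1 := hyperbolicSpace_subset_futureCone hp
  refine lt_of_lt_of_le (mul_pos (sub_pos.2 h1) ?_) (mul_le_neg_mink hY)
  by_contra! h
  exact hne (eq_zero_of_mem_causalCone hY h)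

/-- The endpoint of a curve is determined by the limits of its polar coordinates. -/
theorem IsPastInextendibleTimelike.limit_eq (ha : IsScaleFactor a) (hph : NoParticleHorizons a)
    {p : Mink d} (hp : p ∈ hyperbolicSpace d) {γ : ℝ → ℝ × Mink d}
    (hγ : IsPastInextendibleTimelike a γ) {Y₀ : Mink d}
    (hY : Tendsto (fun s => coneMap a (γ s)) (𝓝[>] 0) (𝓝 Y₀)) {u : ℝ} {ω₀ : Mink d}
    (hu : Tendsto (fun s => nullCoord a p (γ s)) (𝓝[>] 0) (𝓝 u))
    (hω : Tendsto (fun s => angle p (γ s).2) (𝓝[>] 0) (𝓝 ω₀)) :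
    Y₀ = (Real.exp u / 2) • (p + ω₀) := by
  -- An endpoint at the apex would force `u → -∞`.
  have hne : Y₀ ≠ 0 := by
    rintro rfl
    exact not_tendsto_nhds_of_tendsto_atBot (hγ.tendsto_nullCoord_atBot hp hY) u hu
  have hc := neg_mink_pos_of_ne_zero hp (hγ.limit_mem_causalCone hY) hne
  obtain ⟨h1, -, h2⟩ := hγ.tendsto_of_null hp hY (hγ.mink_limit_eq_zero ha hph hY) hc
  rw [tendsto_nhds_unique hu h1, tendsto_nhds_unique hω h2, Real.exp_log (by positivity),
    mul_div_cancel_left₀ _ two_ne_zero, add_sub_cancel, smul_smul, mul_inv_cancel₀ hc.ne',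
    one_smul]

/-- The terminal indecomposable future set of a curve is the future of its endpoint. -/
theorem IsPastInextendibleTimelike.tif_eq (ha : IsScaleFactor a) {γ : ℝ → ℝ × Mink d}
    (hγ : IsPastInextendibleTimelike a γ) {Y₀ : Mink d}
    (hY : Tendsto (fun s => coneMap a (γ s)) (𝓝[>] 0) (𝓝 Y₀)) :
    tif a γ = {q | q ∈ spacetime d ∧ coneMap a q - Y₀ ∈ futureCone d} := by
  ext q
  simp only [tif, mem_iUnion, exists_prop, mem_ofPred_eq]
  constructor
  · rintro ⟨s, hs, hq⟩
    obtain ⟨h1, h2⟩ := (mem_timelikeFuture_iff ha (hγ.mem_spacetime hs)).1 hq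
    refine ⟨h1, ?_⟩
    have h3 : coneMap a (γ s) - Y₀ ∈ causalCone d := by
      refine isClosed_causalCone.mem_of_tendsto (tendsto_const_nhds.sub hY) ?_
      filter_upwards [Ioo_mem_nhdsGT hs.1] with r hr
      exact futureCone_subset_causalCone
        ((hγ.timelike r s hr.1 hr.2 hs.2).coneMap_sub_mem ha)
    have := add_mem_futureCone h2 h3
    rwa [sub_add_sub_cancel] at this
  · rintro ⟨hq, h⟩
    -- The cone is open, so the displacement from `Y₀` may be replaced by that from a nearby point
    -- of the curve.
    have h1 := (tendsto_const_nhds.sub hY).eventually_mem (isOpen_futureCone.mem_nhds h)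
    obtain ⟨s, hs, hs'⟩ := (h1.and (Ioc_mem_nhdsGT one_pos)).exists
    exact ⟨s, hs', (mem_timelikeFuture_iff ha (hγ.mem_spacetime hs')).2 ⟨hq, hs⟩⟩

end FLRW

end

open FLRW
theorem proposition3p8 (d : ℕ) (hd : 2 ≤ d) (a : ℝ → ℝ) (ha : IsScaleFactor a)
    (hph : NoParticleHorizons a) (p : Mink d) (hp : p ∈ hyperbolicSpace d) :
    (∀ γ : ℝ → ℝ × Mink d, IsPastInextendibleTimelike a γ →
      (Tendsto (fun s => nullCoord a p (γ s)) (𝓝[>] 0) atBot ∨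
        ∃ (u₀ : ℝ) (ω₀ : Mink d), ω₀ ∈ unitTangentSphere p ∧
          Tendsto (fun s => nullCoord a p (γ s)) (𝓝[>] 0) (𝓝 u₀) ∧
          Tendsto (fun s => radius p (γ s).2) (𝓝[>] 0) atTop ∧
          Tendsto (fun s => angle p (γ s).2) (𝓝[>] 0) (𝓝 ω₀))) ∧
    (∀ γ : ℝ → ℝ × Mink d, IsPastInextendibleTimelike a γ →
      Tendsto (fun s => nullCoord a p (γ s)) (𝓝[>] 0) atBot →
      tif a γ = spacetime d) ∧
    (∀ (γ₁ γ₂ : ℝ → ℝ × Mink d) (u₁ u₂ : ℝ) (ω₁ ω₂ : Mink d),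
      IsPastInextendibleTimelike a γ₁ → IsPastInextendibleTimelike a γ₂ →
      ω₁ ∈ unitTangentSphere p → ω₂ ∈ unitTangentSphere p →
      Tendsto (fun s => nullCoord a p (γ₁ s)) (𝓝[>] 0) (𝓝 u₁) →
      Tendsto (fun s => nullCoord a p (γ₂ s)) (𝓝[>] 0) (𝓝 u₂) →
      Tendsto (fun s => angle p (γ₁ s).2) (𝓝[>] 0) (𝓝 ω₁) →
      Tendsto (fun s => angle p (γ₂ s).2) (𝓝[>] 0) (𝓝 ω₂) →
      (ω₁ = ω₂ ∧ u₁ = u₂ → tif a γ₁ = tif a γ₂) ∧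
      (ω₁ = ω₂ ∧ u₁ < u₂ → tif a γ₂ ⊆ tif a γ₁)) := by
  refine ⟨fun γ hγ => ?_, fun γ hγ hu => ?_, ?_⟩
  · obtain ⟨Y₀, hY⟩ := hγ.exists_tendsto_coneMap ha
    by_cases h0 : Y₀ = 0
    · subst h0
      exact Or.inl (hγ.tendsto_nullCoord_atBot hp hY)
    · have hnull := hγ.mink_limit_eq_zero ha hph hY
      have hc := neg_mink_pos_of_ne_zero hp (hγ.limit_mem_causalCone hY) h0
      exact Or.inr ⟨_, _, sub_mem_unitTangentSphere hp hnull hc, hγ.tendsto_of_null hp hY hnull hc⟩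
  · obtain ⟨Y₀, hY⟩ := hγ.exists_tendsto_coneMap ha
    obtain rfl := hγ.tendsto_coneMap_zero hp hY hu
    rw [hγ.tif_eq ha hY]
    ext q
    -- With the endpoint at the apex, the cone contains the whole image of `M`.
    simp only [sub_zero, mem_ofPred_eq, and_iff_left_iff_imp]
    exact coneMap_mem_futureCone
  · intro γ₁ γ₂ u₁ u₂ ω₁ ω₂ hγ₁ hγ₂ _ _ hu₁ hu₂ hω₁ hω₂
    obtain ⟨Y₁, hY₁⟩ := hγ₁.exists_tendsto_coneMap ha
    obtain ⟨Y₂, hY₂⟩ := hγ₂.exists_tendsto_coneMap ha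
    have e₁ := hγ₁.limit_eq ha hph hp hY₁ hu₁ hω₁
    have e₂ := hγ₂.limit_eq ha hph hp hY₂ hu₂ hω₂
    rw [hγ₁.tif_eq ha hY₁, hγ₂.tif_eq ha hY₂]
    constructor
    · rintro ⟨rfl, rfl⟩
      rw [e₁, e₂]
    · rintro ⟨rfl, hlt⟩ q ⟨hq, h⟩
      refine ⟨hq, ?_⟩
      -- Equal angles place both endpoints on one null ray, the one with larger `u` further out;
      -- hence its cone lies inside the other.
      have h1 : Y₂ - Y₁ = (Real.exp (u₂ - u₁) - 1) • Y₁ := by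
        rw [e₁, e₂, ← sub_smul, smul_smul, Real.exp_sub]
        congr 1
        have := (Real.exp_pos u₁).ne'
        field_simp
      have h2 : Y₂ - Y₁ ∈ causalCone d := by
        rw [h1]
        refine smul_mem_causalCone (hγ₁.limit_mem_causalCone hY₁) ?_
        rw [sub_nonneg, Real.one_le_exp_iff]
        linarith
      have := add_mem_futureCone h h2
      rwa [sub_add_sub_cancel] at this
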